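/- Let $D\subset\mathbb R^d$, $d\in\{1,2,3\}$, be a bounded Lipschitz domain, and let $(\Omega,\mathcal F,P)$ be a probability space. Let $a_0\in W^{1,\infty}(D)$ satisfy $a_0\ge \alpha$ a.e. in $D$ for a constant $\alpha>0$, and let $\eta:\Omega\to W^{1,\infty}(D)$ be a measurable random field with $\|\eta(\omega,\cdot)\|_{W^{1,\infty}(D)}\le b_0$ for almost every $\omega$, where $b_0>0$ is a constant and $\|u\|_{W^{1,\infty}}=\|u\|_{L^\infty}+\|\nabla u\|_{L^\infty}$. Let $\sigma\in(0,1]$. For $0\le s<1$ let $H_0^{s}(D)$ be the closure of $C_c^\infty(D)$ in the norm $$\|v\|_{H^s(D)}^2=\|v\|_{L^2(D)}^2+\int_D\int_D\frac{|v(x)-v(y)|^2}{|x-y|^{d+2s}}\,dx\,dy$$ (with only the first term if $s=0$), and let $H^{-1+\sigma}(D)$ be the dual of $H_0^{1-\sigma}(D)$ with the dual norm. Let $f\in L^2(\Omega,H^{-1+\sigma}(D))$. Let $\mathcal T_h$ be a partition of $D$ into finitely many pairwise disjoint nonempty open cells with $\overline D=\bigcup_{K\in\mathcal T_h}\overline K$,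 let $r\ge 0$ be an integer, and let $$V_r^h=\{v\in H_0^1(D):\ v|_K \text{ is a polynomial of degree at most } r \text{ for each } K\in\mathcal T_h\},$$ where $H^1_0(D)$ is the closure of $C_c^\infty(D)$ in the norm $\|v\|_{H^1(D)}=(\|v\|_{L^2(D)}^2+\|\nabla v\|_{L^2(D)}^2)^{1/2}$. Then for every $\omega$ there is exactly one sequence $u_0^h(\omega),u_1^h(\omega),\dots$ in $V_r^h$ such that, for all $v^h\in V_r^h$, $$(a_0\nabla u_0^h(\omega),\nabla v^h)_D=\langle f(\omega),v^h\rangle_D,\qquad (a_0\nabla u_n^h(\omega),\nabla v^h)_D=-(\eta(\omega)\nabla u_{n-1}^h(\omega),\nabla v^h)_D\quad(n\ge1),$$ and $u_n^h\in L^2(\Omega,H^1(D))$ with $$\mathbb E\big(\|u_n^h\|_{H^1(D)}^2\big)\le C_0^{\,n+1}\;\mathbb E\big(\|f\|_{H^{-1+\sigma}(D)}^2\big)\qquad\text{for all } n\ge 0.$$ Here the constant $C_0>0$ depends only on $D$, $a_0$ (including $\alpha$), $b_0$ and $\sigma$; in particular it does not depend on $n$, on the partition, on $r$, on $f$, nor,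 when the diffusion coefficient is written $a=a_0+\varepsilon\eta$, on $\varepsilon$ (which does not enter the recursion). -/

import Mathlib

open MeasureTheory Topology
open scoped ENNReal NNReal Gradient

noncomputable section

/-- `ℝᵈ` with the Euclidean norm. -/
abbrev RSpace (d : ℕ) : Type := EuclideanSpace ℝ (Fin d)

/-- A Lipschitz domain: open, connected, nonempty, and near each boundary point `p` it is, for a
suitable unit vector `e`, the set of points lying strictly above the graph (in direction `e`) of a
Lipschitz function of the component orthogonal to `e`. -/
structure IsLipschitzDomain {d : ℕ} (D : Set (RSpace d)) : Prop where
  isOpen : IsOpen D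
  isConnected : IsConnected D
  boundary : ∀ p ∈ frontier D, ∃ e : RSpace d, ‖e‖ = 1 ∧ ∃ ρ : ℝ, 0 < ρ ∧
    ∃ (L : ℝ≥0) (γ : RSpace d → ℝ), LipschitzWith L γ ∧
      ∀ x ∈ Metric.ball p ρ, x ∈ D ↔ γ (x - inner ℝ e x • e) < inner ℝ e x

/-- The test functions `C_c^∞(D)`. -/
structure IsTestFunction {d : ℕ} (D : Set (RSpace d)) (φ : RSpace d → ℝ) : Prop where
  contDiff : ContDiff ℝ ((⊤ : ℕ∞) : WithTop ℕ∞) φ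
  hasCompactSupport : HasCompactSupport φ
  tsupport_subset : tsupport φ ⊆ D

theorem IsTestFunction.zero {d : ℕ} (D : Set (RSpace d)) :
    IsTestFunction D (fun _ => (0 : ℝ)) where
  contDiff := contDiff_const
  hasCompactSupport := HasCompactSupport.zero
  tsupport_subset := by simp [tsupport, Function.support]

theorem IsTestFunction.add {d : ℕ} {D : Set (RSpace d)} {φ ψ : RSpace d → ℝ}
    (hφ : IsTestFunction D φ) (hψ : IsTestFunction D ψ) :
    IsTestFunction D (fun x => φ x + ψ x) where
  contDiff := hφ.contDiff.add hψ.contDiff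
  hasCompactSupport := hφ.hasCompactSupport.add hψ.hasCompactSupport
  tsupport_subset :=
    (tsupport_add φ ψ).trans (Set.union_subset hφ.tsupport_subset hψ.tsupport_subset)

theorem IsTestFunction.smul {d : ℕ} {D : Set (RSpace d)} {φ : RSpace d → ℝ}
    (c : ℝ) (hφ : IsTestFunction D φ) : IsTestFunction D (fun x => c * φ x) where
  contDiff := contDiff_const.mul hφ.contDiff
  hasCompactSupport := hφ.hasCompactSupport.mul_left
  tsupport_subset := (tsupport_mul_subset_right (f := fun _ => c) (g := φ)).trans
    hφ.tsupport_subset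

/-- Lebesgue measure on `D`. -/
abbrev volOn {d : ℕ} (D : Set (RSpace d)) : Measure (RSpace d) := volume.restrict D

/-! ### The space `W^{1,∞}(D)` -/

/-- `g` is the weak gradient of `u` on `D`: `∫_D u ∂_e φ = - ∫_D (g · e) φ` for every test function
`φ` and every vector `e`. -/
def IsWeakGradient {d : ℕ} (D : Set (RSpace d)) (u : RSpace d → ℝ) (g : RSpace d → RSpace d) :
    Prop :=
  ∀ φ : RSpace d → ℝ, IsTestFunction D φ → ∀ e : RSpace d,
    ∫ x in D, u x * fderiv ℝ φ x e = - ∫ x in D, inner ℝ (g x) e * φ x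

theorem integrable_mul_fderiv {d : ℕ} {D : Set (RSpace d)} (u : Lp ℝ ∞ (volOn D))
    {φ : RSpace d → ℝ} (hφ : IsTestFunction D φ) (e : RSpace d) :
    Integrable (fun x => u x * fderiv ℝ φ x e) (volOn D) := by
  have hc : Continuous (fun x => fderiv ℝ φ x e) :=
    (hφ.contDiff.continuous_fderiv (by simp)).clm_apply continuous_const
  have hs : HasCompactSupport (fun x => fderiv ℝ φ x e) := hφ.hasCompactSupport.fderiv_apply ℝ e
  have h1 : Integrable (fun x => fderiv ℝ φ x e) (volOn D) :=
    (hc.integrable_of_hasCompactSupport hs).restrict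
  exact (Lp.memLp u).integrable_mul (memLp_one_iff_integrable.2 h1)

theorem integrable_inner_mul {d : ℕ} {D : Set (RSpace d)} (g : Lp (RSpace d) ∞ (volOn D))
    {φ : RSpace d → ℝ} (hφ : IsTestFunction D φ) (e : RSpace d) :
    Integrable (fun x => inner ℝ (g x) e * φ x) (volOn D) := by
  have h1 : Integrable φ (volOn D) :=
    (hφ.contDiff.continuous.integrable_of_hasCompactSupport hφ.hasCompactSupport).restrict
  exact ((Lp.memLp g).inner_const e).integrable_mul (memLp_one_iff_integrable.2 h1)

/-- `W^{1,∞}(D)`: the pairs `(u, ∇u)` with `u ∈ L^∞(D)` and weak gradient `∇u ∈ L^∞(D)`, with the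
norm `‖u‖_{L^∞} + ‖∇u‖_{L^∞}` (this is what `WithLp 1` says). -/
def W1inf {d : ℕ} (D : Set (RSpace d)) :
    Submodule ℝ (WithLp 1 (Lp ℝ ∞ (volOn D) × Lp (RSpace d) ∞ (volOn D))) where
  carrier := {p | IsWeakGradient D p.fst p.snd}
  zero_mem' := by
    intro φ _ e
    have h1 : ∫ x in D, ((0 : Lp ℝ ∞ (volOn D)) : RSpace d → ℝ) x * fderiv ℝ φ x e = 0 := by
      rw [← integral_zero (RSpace d) ℝ (μ := volOn D)]
      refine integral_congr_ae ?_
      filter_upwards [Lp.coeFn_zero ℝ ∞ (volOn D)] with x hx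
      rw [hx]
      simp
    have h2 : ∫ x in D, inner ℝ (((0 : Lp (RSpace d) ∞ (volOn D)) : RSpace d → RSpace d) x) e * φ x
        = 0 := by
      rw [← integral_zero (RSpace d) ℝ (μ := volOn D)]
      refine integral_congr_ae ?_
      filter_upwards [Lp.coeFn_zero (RSpace d) ∞ (volOn D)] with x hx
      rw [hx]
      simp
    change ∫ x in D, ((0 : Lp ℝ ∞ (volOn D)) : RSpace d → ℝ) x * fderiv ℝ φ x e
      = - ∫ x in D, inner ℝ (((0 : Lp (RSpace d) ∞ (volOn D)) : RSpace d → RSpace d) x) e * φ x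
    rw [h1, h2, neg_zero]
  add_mem' := by
    intro p q hp hq φ hφ e
    have h1 : ∫ x in D, (p + q).fst x * fderiv ℝ φ x e
        = ∫ x in D, (p.fst x * fderiv ℝ φ x e + q.fst x * fderiv ℝ φ x e) := by
      refine integral_congr_ae ?_
      filter_upwards [Lp.coeFn_add p.fst q.fst] with x hx
      rw [WithLp.add_fst, hx, Pi.add_apply, add_mul]
    have h2 : ∫ x in D, inner ℝ ((p + q).snd x) e * φ x
        = ∫ x in D, (inner ℝ (p.snd x) e * φ x + inner ℝ (q.snd x) e * φ x) := by
      refine integral_congr_ae ?_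
      filter_upwards [Lp.coeFn_add p.snd q.snd] with x hx
      rw [WithLp.add_snd, hx, Pi.add_apply, inner_add_left, add_mul]
    rw [h1, h2, integral_add (integrable_mul_fderiv _ hφ e) (integrable_mul_fderiv _ hφ e),
      integral_add (integrable_inner_mul _ hφ e) (integrable_inner_mul _ hφ e), hp φ hφ e,
      hq φ hφ e]
    ring
  smul_mem' := by
    intro c p hp φ hφ e
    have h1 : ∫ x in D, (c • p).fst x * fderiv ℝ φ x e
        = ∫ x in D, c * (p.fst x * fderiv ℝ φ x e) := by
      refine integral_congr_ae ?_
      filter_upwards [Lp.coeFn_smul c p.fst] with x hx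
      rw [WithLp.smul_fst, hx, Pi.smul_apply, smul_eq_mul, mul_assoc]
    have h2 : ∫ x in D, inner ℝ ((c • p).snd x) e * φ x
        = ∫ x in D, c * (inner ℝ (p.snd x) e * φ x) := by
      refine integral_congr_ae ?_
      filter_upwards [Lp.coeFn_smul c p.snd] with x hx
      rw [WithLp.smul_snd, hx, Pi.smul_apply, real_inner_smul_left, mul_assoc]
    rw [h1, h2, integral_const_mul, integral_const_mul, hp φ hφ e]
    ring

/-- The underlying function of an element of `W^{1,∞}(D)`. -/
def W1inf.fn {d : ℕ} {D : Set (RSpace d)} (a : W1inf D) : Lp ℝ ∞ (volOn D) := a.1.fst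

/-! ### The spaces `H_0^1(D)` and `H_0^s(D)`, `0 ≤ s < 1` -/

/-- The pairs `(φ, ∇φ)`, `φ ∈ C_c^∞(D)`, inside `L²(D) × L²(D; ℝᵈ)`. -/
def testPairs {d : ℕ} (D : Set (RSpace d)) :
    Submodule ℝ (WithLp 2 (Lp ℝ 2 (volOn D) × Lp (RSpace d) 2 (volOn D))) where
  carrier := {p | ∃ φ : RSpace d → ℝ, IsTestFunction D φ ∧
    p.fst =ᵐ[volOn D] φ ∧ p.snd =ᵐ[volOn D] fun x => ∇ φ x}
  zero_mem' := by
    refine ⟨_, IsTestFunction.zero D, Lp.coeFn_zero ℝ 2 (volOn D), ?_⟩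
    filter_upwards [Lp.coeFn_zero (RSpace d) 2 (volOn D)] with x hx
    have h0 : ∇ (fun _ : RSpace d => (0 : ℝ)) x = 0 := by simp [gradient]
    rw [h0]
    exact hx
  add_mem' := by
    rintro p q ⟨φ, hφ, hp, hp'⟩ ⟨ψ, hψ, hq, hq'⟩
    refine ⟨_, hφ.add hψ, ?_, ?_⟩
    · filter_upwards [Lp.coeFn_add p.fst q.fst, hp, hq] with x hx h1 h2
      rw [WithLp.add_fst, hx, Pi.add_apply, h1, h2]
    · filter_upwards [Lp.coeFn_add p.snd q.snd, hp', hq'] with x hx h1 h2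
      rw [WithLp.add_snd, hx, Pi.add_apply, h1, h2]
      have e1 := (hφ.contDiff.differentiable (by simp)) x
      have e2 := (hψ.contDiff.differentiable (by simp)) x
      simp only [gradient]
      rw [fderiv_fun_add e1 e2, map_add]
  smul_mem' := by
    rintro c p ⟨φ, hφ, hp, hp'⟩
    refine ⟨_, hφ.smul c, ?_, ?_⟩
    · filter_upwards [Lp.coeFn_smul c p.fst, hp] with x hx h1
      rw [WithLp.smul_fst, hx, Pi.smul_apply, h1, smul_eq_mul]
    · filter_upwards [Lp.coeFn_smul c p.snd, hp'] with x hx h1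
      rw [WithLp.smul_snd, hx, Pi.smul_apply, h1]
      have e1 := (hφ.contDiff.differentiable (by simp)) x
      simp only [gradient]
      rw [fderiv_const_mul e1]
      simp

/-- `H_0^1(D)`: the closure of `C_c^∞(D)` for the norm `(‖v‖²_{L²} + ‖∇v‖²_{L²})^{1/2}`. An element
is stored as the pair `(v, ∇v)`. -/
def H01 {d : ℕ} (D : Set (RSpace d)) :
    Submodule ℝ (WithLp 2 (Lp ℝ 2 (volOn D) × Lp (RSpace d) 2 (volOn D))) :=
  (testPairs D).topologicalClosure

/-- The underlying function of an element of `H_0^1(D)`. -/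
def H01.fn {d : ℕ} {D : Set (RSpace d)} (v : H01 D) : Lp ℝ 2 (volOn D) := v.1.fst

/-- The (weak) gradient of an element of `H_0^1(D)`. -/
def H01.grad {d : ℕ} {D : Set (RSpace d)} (v : H01 D) : Lp (RSpace d) 2 (volOn D) := v.1.snd

/-- The measure `|x - y|^{-(d + 2 s)} dx dy` on `D × D` for `s ≠ 0`. For `s = 0` it is the zero
measure, so that there is no seminorm term and `H^0(D) = L²(D)`. -/
def gagliardoMeasure {d : ℕ} (D : Set (RSpace d)) (s : ℝ) : Measure (RSpace d × RSpace d) :=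
  if s = 0 then 0 else
    ((volOn D).prod (volOn D)).withDensity
      (fun z => ENNReal.ofReal (‖z.1 - z.2‖ ^ (-((d : ℝ) + 2 * s))))

/-- The pairs `(φ, φ(x) - φ(y))`, `φ ∈ C_c^∞(D)`, inside `L²(D) × L²(D × D; |x-y|^{-(d+2s)} dx dy)`.
-/
def testPairsFrac {d : ℕ} (D : Set (RSpace d)) (s : ℝ) :
    Submodule ℝ (WithLp 2 (Lp ℝ 2 (volOn D) × Lp ℝ 2 (gagliardoMeasure D s))) where
  carrier := {p | ∃ φ : RSpace d → ℝ, IsTestFunction D φ ∧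
    p.fst =ᵐ[volOn D] φ ∧ p.snd =ᵐ[gagliardoMeasure D s] fun z => φ z.1 - φ z.2}
  zero_mem' := by
    refine ⟨_, IsTestFunction.zero D, Lp.coeFn_zero ℝ 2 (volOn D), ?_⟩
    filter_upwards [Lp.coeFn_zero ℝ 2 (gagliardoMeasure D s)] with x hx
    rw [sub_zero]
    exact hx
  add_mem' := by
    rintro p q ⟨φ, hφ, hp, hp'⟩ ⟨ψ, hψ, hq, hq'⟩
    refine ⟨_, hφ.add hψ, ?_, ?_⟩
    · filter_upwards [Lp.coeFn_add p.fst q.fst, hp, hq] with x hx h1 h2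
      rw [WithLp.add_fst, hx, Pi.add_apply, h1, h2]
    · filter_upwards [Lp.coeFn_add p.snd q.snd, hp', hq'] with x hx h1 h2
      rw [WithLp.add_snd, hx, Pi.add_apply, h1, h2]
      ring
  smul_mem' := by
    rintro c p ⟨φ, hφ, hp, hp'⟩
    refine ⟨_, hφ.smul c, ?_, ?_⟩
    · filter_upwards [Lp.coeFn_smul c p.fst, hp] with x hx h1
      rw [WithLp.smul_fst, hx, Pi.smul_apply, h1, smul_eq_mul]
    · filter_upwards [Lp.coeFn_smul c p.snd, hp'] with x hx h1
      rw [WithLp.smul_snd, hx, Pi.smul_apply, h1, smul_eq_mul]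
      ring

/-- `H_0^s(D)`, `0 ≤ s < 1`: the closure of `C_c^∞(D)` for the norm whose square is
`‖v‖²_{L²(D)} + ∫_D ∫_D |v(x) - v(y)|² / |x - y|^{d + 2 s} dx dy` (for `s = 0` just `‖v‖²_{L²(D)}`).
An element is stored as the pair `(v, v(x) - v(y))`. -/
def H0s {d : ℕ} (D : Set (RSpace d)) (s : ℝ) :
    Submodule ℝ (WithLp 2 (Lp ℝ 2 (volOn D) × Lp ℝ 2 (gagliardoMeasure D s))) :=
  (testPairsFrac D s).topologicalClosure

/-- The underlying function of an element of `H_0^s(D)`. -/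
def H0s.fn {d : ℕ} {D : Set (RSpace d)} {s : ℝ} (v : H0s D s) : Lp ℝ 2 (volOn D) := v.1.fst

/-- `H^{-s}(D)`, `0 ≤ s < 1`: the dual of `H_0^s(D)`, with the dual norm. -/
abbrev Hneg {d : ℕ} (D : Set (RSpace d)) (s : ℝ) : Type := StrongDual ℝ (H0s D s)

/-! ### Finite elements -/

/-- A partition of `D` into finitely many cells. -/
structure FEPartition {d : ℕ} (D : Set (RSpace d)) where
  cells : Finset (Set (RSpace d))
  isOpen : ∀ K ∈ cells, IsOpen K
  nonempty : ∀ K ∈ cells, K.Nonempty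
  subset : ∀ K ∈ cells, K ⊆ D
  disjoint : ∀ K ∈ cells, ∀ K' ∈ cells, K ≠ K' → Disjoint K K'
  closure_eq : closure D = ⋃ K ∈ cells, closure K

/-- The finite element space `V_r^h`: the functions in `H_0^1(D)` whose restriction to each cell is
a polynomial of degree at most `r`. -/
def feSpace {d : ℕ} {D : Set (RSpace d)} (T : FEPartition D) (r : ℕ) : Submodule ℝ (H01 D) where
  carrier := {v | ∀ K ∈ T.cells, ∃ p : MvPolynomial (Fin d) ℝ, p.totalDegree ≤ r ∧
    H01.fn v =ᵐ[volume.restrict K] fun x => MvPolynomial.eval (fun i => x i) p}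
  zero_mem' := by
    intro K hK
    refine ⟨0, by simp, ?_⟩
    have h := ae_restrict_of_ae_restrict_of_subset (T.subset K hK)
      (Lp.coeFn_zero ℝ 2 (volOn D))
    filter_upwards [h] with x hx
    rw [map_zero]
    exact hx
  add_mem' := by
    intro u v hu hv K hK
    obtain ⟨p, hp, hp'⟩ := hu K hK
    obtain ⟨q, hq, hq'⟩ := hv K hK
    refine ⟨p + q, (MvPolynomial.totalDegree_add p q).trans (max_le hp hq), ?_⟩
    have h := ae_restrict_of_ae_restrict_of_subset (T.subset K hK)
      (Lp.coeFn_add (H01.fn u) (H01.fn v))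
    filter_upwards [h, hp', hq'] with x hx h1 h2
    rw [map_add, ← h1, ← h2]
    exact hx
  smul_mem' := by
    intro c u hu K hK
    obtain ⟨p, hp, hp'⟩ := hu K hK
    refine ⟨c • p, (MvPolynomial.totalDegree_smul_le c p).trans hp, ?_⟩
    have h := ae_restrict_of_ae_restrict_of_subset (T.subset K hK)
      (Lp.coeFn_smul c (H01.fn u))
    filter_upwards [h, hp'] with x hx h1
    rw [MvPolynomial.smul_eval, ← h1]
    exact hx

/-- `(a ∇u, ∇v)_D = ∫_D a ∇u · ∇v dx`. -/
def diffusionForm {d : ℕ} {D : Set (RSpace d)} (a : W1inf D) (u v : H01 D) : ℝ :=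
  ∫ x in D, W1inf.fn a x * inner ℝ (H01.grad u x) (H01.grad v x)

/-- For one realization `η` of the random field and `F ∈ H^{-s}(D)` of the source, `u 0, u 1, …`
solve recursively, in the finite element space `V`,
`(a₀ ∇u₀, ∇v) = ⟨F, v⟩` and `(a₀ ∇uₙ₊₁, ∇v) = -(η ∇uₙ, ∇v)` for all `v ∈ V`.
In the pairing `⟨F, v⟩`, the function `v ∈ H_0^1(D) ⊆ H_0^s(D)` is viewed as the element `w` of
`H_0^s(D)` with the same underlying function. -/
structure IsFEModes {d : ℕ} {D : Set (RSpace d)} {s : ℝ} (V : Submodule ℝ (H01 D))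
    (a₀ η : W1inf D) (F : Hneg D s) (u : ℕ → V) : Prop where
  zero : ∀ v : V, ∀ w : H0s D s, H0s.fn w = H01.fn (v : H01 D) →
    diffusionForm a₀ (u 0) v = F w
  succ : ∀ n : ℕ, ∀ v : V, diffusionForm a₀ (u (n + 1)) v = - diffusionForm η (u n) v

end

/-!
The recursion is a sequence of coercive problems with one and the same left-hand side, so each mode
is obtained from the previous one by a bounded linear solution operator, and the bound multiplies
by a fixed constant at every step. What has to be seen is that this constant does not depend on the
finite element space.

Everything analytic rests on one inequality for `φ ∈ C_c^∞(D)`, extended by zero: a translation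
satisfies `‖φ(· + h) - φ‖_{L²} ≤ |h| ‖∇φ‖_{L²}` (`lintegral_translate_sub_sq_le`).

* If `|h|` exceeds the diameter of `D`, then `φ(· + h)` vanishes on `D`, which gives the Poincaré
  inequality (`exists_poincare_const`). Hence `(a₀ ∇u, ∇v)` is coercive on `H_0^1(D)`, and on every
  subspace with the same constant.
* Multiplying by `|h|^{-(d + 2s)}` and integrating over a ball of radius larger than the diameter
  bounds the Gagliardo seminorm by `‖∇φ‖_{L²}`, since `s < 1` makes `|h|^{2 - d - 2s}` integrable
  (`exists_gagliardo_const`). By density `H_0^1(D)` embeds continuously into `H_0^s(D)`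
  (`exists_embedding_H01_H0s`); an element of `H_0^s(D)` is determined by its underlying function
  (`H0s_fn_injective`), so the pairing of `f` with finite element functions is a bounded functional.

The finite element space is closed in `H_0^1(D)` (`isClosed_feSpace`), so Lax–Milgram applies to it
and gives existence and uniqueness (`existsUnique_isModes`). Testing the equations with their own
solutions gives the bound for a fixed realization (`IsModes.norm_le`), with a constant made of the
coercivity constant, the norm of the embedding and `b₀`.

For the measurability in `ω`, the `n`-th mode is a continuous function of `(η, uₙ₋₁)`. The space
`W^{1,∞}(D)` is not separable, but the finite element space is, and a product with one second
countable factor has the Borel structure one needs (`aestronglyMeasurable_comp_borel`).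
-/

/-! ### Translation estimate for smooth functions -/

theorem enorm_fderiv_le_gradient {d : ℕ} (φ : RSpace d → ℝ) (x h : RSpace d) :
    ‖fderiv ℝ φ x h‖ₑ ≤ ‖∇ φ x‖ₑ * ‖h‖ₑ := by
  have h1 : ‖fderiv ℝ φ x‖ₑ = ‖∇ φ x‖ₑ := by
    rw [gradient, LinearIsometryEquiv.enorm_map]
  rw [← h1]
  exact ContinuousLinearMap.le_opENorm _ _

theorem continuous_gradient {d : ℕ} {φ : RSpace d → ℝ} (hφ : ContDiff ℝ 1 φ) :
    Continuous (fun x => ∇ φ x) :=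
  (InnerProductSpace.toDual ℝ (RSpace d)).symm.continuous.comp
    (hφ.continuous_fderiv one_ne_zero)

/-- On a probability space, the square of an integral is at most the integral of the square. -/
theorem sq_lintegral_le_lintegral_sq {X : Type*} [MeasurableSpace X] (μ : Measure X)
    [IsProbabilityMeasure μ] {f : X → ℝ≥0∞} (hf : AEMeasurable f μ) :
    (∫⁻ x, f x ∂μ) ^ 2 ≤ ∫⁻ x, f x ^ 2 ∂μ := by
  have h := ENNReal.lintegral_mul_le_Lp_mul_Lq μ Real.HolderConjugate.two_two hf
    (aemeasurable_const (b := (1 : ℝ≥0∞)))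
  simp only [Pi.mul_apply, mul_one, ENNReal.one_rpow, lintegral_const, measure_univ] at h
  calc (∫⁻ x, f x ∂μ) ^ 2 ≤ ((∫⁻ x, f x ^ (2 : ℝ) ∂μ) ^ (1 / 2 : ℝ)) ^ 2 := by gcongr
    _ = ∫⁻ x, f x ^ 2 ∂μ := by
      rw [← ENNReal.rpow_natCast, ← ENNReal.rpow_mul]
      norm_num

theorem enorm_translate_sub_sq_le {d : ℕ} {φ : RSpace d → ℝ} (hφ : ContDiff ℝ 1 φ)
    (x h : RSpace d) :
    ‖φ (x + h) - φ x‖ₑ ^ 2 ≤ ∫⁻ t in Set.Icc (0 : ℝ) 1, (‖∇ φ (x + t • h)‖ₑ * ‖h‖ₑ) ^ 2 := by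
  have hg : ContDiff ℝ 1 (fun t : ℝ => φ (x + t • h)) := by fun_prop
  have hd : ∀ t : ℝ, deriv (fun t : ℝ => φ (x + t • h)) t = fderiv ℝ φ (x + t • h) h := by
    intro t
    have h1 : HasDerivAt (fun t : ℝ => x + t • h) h t := by
      simpa using ((hasDerivAt_id t).smul_const h).const_add x
    exact (((hφ.differentiable one_ne_zero) _).hasFDerivAt.comp_hasDerivAt t h1).deriv
  have h1 := enorm_sub_le_lintegral_deriv_of_contDiffOn_Icc hg.contDiffOn zero_le_one
  simp only [one_smul, zero_smul, add_zero, hd] at h1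
  have : IsProbabilityMeasure (volume.restrict (Set.Icc (0 : ℝ) 1)) := ⟨by simp⟩
  have hc : Continuous (fun t : ℝ => ‖∇ φ (x + t • h)‖ₑ) :=
    ((continuous_gradient hφ).comp (by fun_prop)).enorm
  calc ‖φ (x + h) - φ x‖ₑ ^ 2
      ≤ (∫⁻ t in Set.Icc (0 : ℝ) 1, ‖∇ φ (x + t • h)‖ₑ * ‖h‖ₑ) ^ 2 := by
        gcongr
        exact h1.trans (lintegral_mono fun t => enorm_fderiv_le_gradient _ _ _)
    _ ≤ _ := sq_lintegral_le_lintegral_sq _ (hc.measurable.mul_const _).aemeasurable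

/-- The translation estimate `‖φ(· + h) - φ‖_{L²} ≤ |h| ‖∇φ‖_{L²}`. Both the Poincaré inequality
and the bound of the Gagliardo seminorm follow from it. -/
theorem lintegral_translate_sub_sq_le {d : ℕ} {φ : RSpace d → ℝ} (hφ : ContDiff ℝ 1 φ)
    (h : RSpace d) :
    ∫⁻ x, ‖φ (x + h) - φ x‖ₑ ^ 2 ≤ ‖h‖ₑ ^ 2 * ∫⁻ x, ‖∇ φ x‖ₑ ^ 2 := by
  have hc : Continuous (fun p : RSpace d × ℝ => ‖∇ φ (p.1 + p.2 • h)‖ₑ) :=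
    ((continuous_gradient hφ).comp (by fun_prop)).enorm
  have hc' : Continuous (fun x : RSpace d => ‖∇ φ x‖ₑ) := (continuous_gradient hφ).enorm
  calc ∫⁻ x, ‖φ (x + h) - φ x‖ₑ ^ 2
      ≤ ∫⁻ x, ∫⁻ t in Set.Icc (0 : ℝ) 1, (‖∇ φ (x + t • h)‖ₑ * ‖h‖ₑ) ^ 2 :=
        lintegral_mono fun x => enorm_translate_sub_sq_le hφ x h
    _ = ∫⁻ t in Set.Icc (0 : ℝ) 1, ∫⁻ x, (‖∇ φ (x + t • h)‖ₑ * ‖h‖ₑ) ^ 2 :=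
        lintegral_lintegral_swap ((hc.measurable.mul_const _).pow_const 2).aemeasurable
    _ = ∫⁻ t in Set.Icc (0 : ℝ) 1, ‖h‖ₑ ^ 2 * ∫⁻ x, ‖∇ φ x‖ₑ ^ 2 := by
        congr 1
        funext t
        rw [lintegral_add_right_eq_self (fun x => (‖∇ φ x‖ₑ * ‖h‖ₑ) ^ 2) (t • h)]
        simp_rw [mul_pow]
        rw [lintegral_mul_const _ (hc'.measurable.pow_const 2), mul_comm]
    _ = _ := by simp

/-! ### Poincaré inequality and Gagliardo seminorm of test functions -/

theorem IsTestFunction.gradient_eq_zero {d : ℕ} {D : Set (RSpace d)} {φ : RSpace d → ℝ}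
    (hφ : IsTestFunction D φ) {x : RSpace d} (hx : x ∉ D) : ∇ φ x = 0 := by
  have h1 : x ∉ tsupport φ := fun h => hx (hφ.tsupport_subset h)
  have h2 : fderiv ℝ φ x = 0 := by
    by_contra h3
    exact h1 (support_fderiv_subset ℝ h3)
  rw [gradient, h2, map_zero]

theorem IsTestFunction.eq_zero {d : ℕ} {D : Set (RSpace d)} {φ : RSpace d → ℝ}
    (hφ : IsTestFunction D φ) {x : RSpace d} (hx : x ∉ D) : φ x = 0 :=
  image_eq_zero_of_notMem_tsupport fun h => hx (hφ.tsupport_subset h)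

theorem IsTestFunction.contDiff_one {d : ℕ} {D : Set (RSpace d)} {φ : RSpace d → ℝ}
    (hφ : IsTestFunction D φ) : ContDiff ℝ 1 φ := hφ.contDiff.of_le (by simp)

theorem IsTestFunction.setLIntegral_gradient {d : ℕ} {D : Set (RSpace d)} {φ : RSpace d → ℝ}
    (hφ : IsTestFunction D φ) : ∫⁻ x in D, ‖∇ φ x‖ₑ ^ 2 = ∫⁻ x, ‖∇ φ x‖ₑ ^ 2 := by
  refine setLIntegral_eq_of_support_subset fun x hx => ?_
  by_contra h
  exact hx (by simp [hφ.gradient_eq_zero h])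

/-- The Poincaré inequality for test functions on a bounded set: a translation longer than the
diameter of `D` moves `D` off itself, so that `φ(x + h) = 0` for `x ∈ D`. -/
theorem exists_poincare_const {d : ℕ} (hd : 1 ≤ d) {D : Set (RSpace d)}
    (hDb : Bornology.IsBounded D) :
    ∃ C : ℝ≥0, ∀ φ : RSpace d → ℝ, IsTestFunction D φ →
      ∫⁻ x in D, ‖φ x‖ₑ ^ 2 ≤ C * ∫⁻ x in D, ‖∇ φ x‖ₑ ^ 2 := by
  have : Nonempty (Fin d) := ⟨⟨0, hd⟩⟩
  obtain ⟨h, hh⟩ := exists_norm_eq (RSpace d)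
    (show (0 : ℝ) ≤ Metric.diam D + 1 by positivity)
  refine ⟨‖h‖₊ ^ 2, fun φ hφ => ?_⟩
  rw [hφ.setLIntegral_gradient]
  push_cast
  refine le_trans ?_ (lintegral_translate_sub_sq_le hφ.contDiff_one h)
  rw [setLIntegral_eq_of_support_subset (fun x hx => by
    by_contra h
    exact hx (by simp [hφ.eq_zero h]))]
  refine lintegral_mono fun x => ?_
  by_cases hx : x ∈ D
  · have hx' : x + h ∉ D := by
      intro hx'
      have := Metric.dist_le_diam_of_mem hDb hx' hx
      rw [dist_eq_norm, add_sub_cancel_left, hh] at this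
      linarith
    simp [hφ.eq_zero hx']
  · simp [hφ.eq_zero hx]

/-- The kernel `|h|^{-(d+2s)} |h|²` is integrable near the origin because `s < 1`. -/
theorem lintegral_ball_kernel_lt_top {d : ℕ} (hd : 1 ≤ d) {s : ℝ} (hs : s < 1) (R : ℝ) :
    ∫⁻ h in Metric.ball (0 : RSpace d) R,
      ENNReal.ofReal (‖h‖ ^ (-((d : ℝ) + 2 * s))) * ‖h‖ₑ ^ 2 < ∞ := by
  have : Nonempty (Fin d) := ⟨⟨0, hd⟩⟩
  rcases le_or_gt R 0 with hR | hR
  · simp [Metric.ball_eq_empty.2 hR]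
  have h1 : IntegrableOn (fun h : RSpace d => ‖h‖ ^ (-((d : ℝ) + 2 * s)) * ‖h‖ ^ 2)
      (Metric.ball 0 R) := by
    refine (integrableOn_fun_norm_addHaar volume
      (f := fun y : ℝ => y ^ (-((d : ℝ) + 2 * s)) * y ^ 2)).2 ?_
    have h2 : IntegrableOn (fun y : ℝ => y ^ (1 - 2 * s)) (Set.Ioo 0 R) :=
      (intervalIntegral.integrableOn_Ioo_rpow_iff hR).2 (by linarith)
    refine h2.congr_fun (fun y hy => ?_) measurableSet_Ioo
    have hy : 0 < y := hy.1
    simp only [finrank_euclideanSpace_fin, smul_eq_mul]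
    rw [← Real.rpow_natCast y (d - 1), ← Real.rpow_natCast y 2, ← Real.rpow_add hy,
      ← Real.rpow_add hy, Nat.cast_sub hd]
    congr 1
    push_cast
    ring
  refine lt_of_eq_of_lt ?_ h1.2
  refine lintegral_congr fun h => ?_
  rw [enorm_mul, enorm_pow, enorm_norm, Real.enorm_of_nonneg (by positivity)]

/-- On a bounded set the Gagliardo seminorm of a test function is controlled by the `L²` norm of its
gradient: in the variables `y` and `h = x - y` this is the translation estimate, integrated against
the kernel over a ball that contains `D - D`. -/
theorem exists_gagliardo_const {d : ℕ} (hd : 1 ≤ d) {D : Set (RSpace d)}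
    (hDm : MeasurableSet D) (hDb : Bornology.IsBounded D) {s : ℝ} (hs : s < 1) :
    ∃ C : ℝ≥0, ∀ φ : RSpace d → ℝ, IsTestFunction D φ →
      ∫⁻ z, ‖φ z.1 - φ z.2‖ₑ ^ 2 ∂(gagliardoMeasure D s) ≤ C * ∫⁻ x in D, ‖∇ φ x‖ₑ ^ 2 := by
  rcases eq_or_ne s 0 with h0 | h0
  · exact ⟨0, fun φ _ => by simp [gagliardoMeasure, h0]⟩
  set R := Metric.diam D + 1 with hR
  set k : RSpace d → ℝ≥0∞ := fun h => ENNReal.ofReal (‖h‖ ^ (-((d : ℝ) + 2 * s))) with hk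
  have hkm : Measurable k := by fun_prop
  set κ : RSpace d → ℝ≥0∞ := (Metric.ball 0 R).indicator k with hκ
  have hκm : Measurable κ := hkm.indicator measurableSet_ball
  have hfin := lintegral_ball_kernel_lt_top hd hs R
  refine ⟨(∫⁻ h in Metric.ball (0 : RSpace d) R, k h * ‖h‖ₑ ^ 2).toNNReal, fun φ hφ => ?_⟩
  rw [ENNReal.coe_toNNReal hfin.ne, hφ.setLIntegral_gradient]
  have hφc : Continuous φ := hφ.contDiff.continuous
  have hm : Measurable (fun z : RSpace d × RSpace d => ‖φ z.1 - φ z.2‖ₑ ^ 2) := by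
    have : Continuous (fun z : RSpace d × RSpace d => ‖φ z.1 - φ z.2‖ₑ) :=
      Continuous.enorm (by fun_prop)
    exact this.measurable.pow_const 2
  have hkm2 : Measurable (fun z : RSpace d × RSpace d => k (z.1 - z.2)) :=
    hkm.comp (by fun_prop)
  have hm2 : Measurable (fun z : RSpace d × RSpace d => κ z.2 * ‖φ (z.1 + z.2) - φ z.1‖ₑ ^ 2) := by
    have : Continuous (fun z : RSpace d × RSpace d => ‖φ (z.1 + z.2) - φ z.1‖ₑ) :=
      Continuous.enorm (by fun_prop)
    exact (hκm.comp measurable_snd).mul (this.measurable.pow_const 2)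
  rw [gagliardoMeasure, if_neg h0, lintegral_withDensity_eq_lintegral_mul _ hkm2 hm,
    lintegral_prod_symm' _ (hkm2.mul hm)]
  calc ∫⁻ y in D, ∫⁻ x in D, k (x - y) * ‖φ x - φ y‖ₑ ^ 2
      ≤ ∫⁻ y, ∫⁻ x, κ (x - y) * ‖φ x - φ y‖ₑ ^ 2 := by
        -- `κ` and `k` agree at `x - y` as long as both points lie in `D`
        refine le_trans (b := ∫⁻ y in D, ∫⁻ x in D, κ (x - y) * ‖φ x - φ y‖ₑ ^ 2) ?_
          ((setLIntegral_le_lintegral _ _).trans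
            (lintegral_mono fun y => setLIntegral_le_lintegral _ _))
        refine setLIntegral_mono' hDm fun y hy => setLIntegral_mono' hDm fun x hx => ?_
        have hxy : x - y ∈ Metric.ball (0 : RSpace d) R := by
          rw [mem_ball_zero_iff, ← dist_eq_norm]
          exact (Metric.dist_le_diam_of_mem hDb hx hy).trans_lt (by simp [hR])
        rw [hκ, Set.indicator_of_mem hxy]
    _ = ∫⁻ y, ∫⁻ h, κ h * ‖φ (y + h) - φ y‖ₑ ^ 2 := by
        refine lintegral_congr fun y => ?_
        rw [← lintegral_add_left_eq_self _ y]
        simp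
    _ = ∫⁻ h, ∫⁻ y, κ h * ‖φ (y + h) - φ y‖ₑ ^ 2 :=
        lintegral_lintegral_swap hm2.aemeasurable
    _ ≤ ∫⁻ h, (κ h * ‖h‖ₑ ^ 2) * ∫⁻ x, ‖∇ φ x‖ₑ ^ 2 := by
        refine lintegral_mono fun h => ?_
        have : Continuous (fun y : RSpace d => ‖φ (y + h) - φ y‖ₑ) :=
          Continuous.enorm (by fun_prop)
        rw [lintegral_const_mul _ (this.measurable.pow_const 2), mul_assoc]
        gcongr
        exact lintegral_translate_sub_sq_le hφ.contDiff_one h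
    _ = _ := by
        rw [lintegral_mul_const _ (by fun_prop), ← lintegral_indicator measurableSet_ball]
        congr 2
        funext h
        by_cases hh : h ∈ Metric.ball (0 : RSpace d) R <;> simp [hκ, hh, hk]

/-! ### The norms of `L²` as integrals -/

theorem Lp_two_enorm_sq {X E : Type*} [MeasurableSpace X] {μ : Measure X} [NormedAddCommGroup E]
    (f : Lp E 2 μ) : ‖f‖ₑ ^ 2 = ∫⁻ x, ‖f x‖ₑ ^ 2 ∂μ := by
  have h := eLpNorm_nnreal_pow_eq_lintegral (f := f) (μ := μ) (p := 2) two_ne_zero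
  rw [Lp.enorm_def]
  simpa using h

theorem lintegral_enorm_sq_congr {X E : Type*} [MeasurableSpace X] {μ : Measure X}
    [NormedAddCommGroup E] {f g : X → E} (h : f =ᵐ[μ] g) :
    ∫⁻ x, ‖f x‖ₑ ^ 2 ∂μ = ∫⁻ x, ‖g x‖ₑ ^ 2 ∂μ :=
  lintegral_congr_ae (h.mono fun x hx => by simp only [hx])

theorem Lp_two_norm_sq_le {X Y E F : Type*} [MeasurableSpace X] [MeasurableSpace Y]
    {μ : Measure X} {ν : Measure Y} [NormedAddCommGroup E] [NormedAddCommGroup F]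
    {f : Lp E 2 μ} {g : Lp F 2 ν} {C : ℝ≥0}
    (h : ∫⁻ x, ‖f x‖ₑ ^ 2 ∂μ ≤ C * ∫⁻ y, ‖g y‖ₑ ^ 2 ∂ν) : ‖f‖ ^ 2 ≤ C * ‖g‖ ^ 2 := by
  rw [← Lp_two_enorm_sq, ← Lp_two_enorm_sq, ← ofReal_norm, ← ofReal_norm,
    ← ENNReal.ofReal_pow (norm_nonneg _), ← ENNReal.ofReal_pow (norm_nonneg _),
    ← ENNReal.ofReal_coe_nnreal, ← ENNReal.ofReal_mul (by positivity),
    ENNReal.ofReal_le_ofReal_iff (by positivity)] at h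
  exact h

/-! ### Poincaré inequality on `H_0^1(D)` -/

theorem exists_norm_fn_sq_le {d : ℕ} (hd : 1 ≤ d) {D : Set (RSpace d)}
    (hDb : Bornology.IsBounded D) :
    ∃ C : ℝ≥0, ∀ v : H01 D, ‖H01.fn v‖ ^ 2 ≤ C * ‖H01.grad v‖ ^ 2 := by
  obtain ⟨C, hC⟩ := exists_poincare_const hd hDb
  refine ⟨C, fun v => ?_⟩
  have hcl : IsClosed {p : WithLp 2 (Lp ℝ 2 (volOn D) × Lp (RSpace d) 2 (volOn D)) |
      ‖p.fst‖ ^ 2 ≤ C * ‖p.snd‖ ^ 2} :=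
    isClosed_le (by fun_prop) (by fun_prop)
  refine closure_minimal ?_ hcl v.2
  rintro p ⟨φ, hφ, h1, h2⟩
  refine Lp_two_norm_sq_le ?_
  rw [lintegral_enorm_sq_congr h1,
    lintegral_enorm_sq_congr h2]
  exact hC φ hφ

theorem H01_norm_sq {d : ℕ} {D : Set (RSpace d)} (v : H01 D) :
    ‖v‖ ^ 2 = ‖H01.fn v‖ ^ 2 + ‖H01.grad v‖ ^ 2 :=
  WithLp.prod_norm_sq_eq_of_L2 v.1

theorem H01_norm_grad_le {d : ℕ} {D : Set (RSpace d)} (v : H01 D) : ‖H01.grad v‖ ≤ ‖v‖ :=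
  WithLp.norm_snd_le (x := v.1)

/-- By the Poincaré inequality the gradient controls the whole `H¹` norm. -/
theorem exists_norm_sq_le_grad {d : ℕ} (hd : 1 ≤ d) {D : Set (RSpace d)}
    (hDb : Bornology.IsBounded D) :
    ∃ c : ℝ, 0 < c ∧ ∀ v : H01 D, c * ‖v‖ ^ 2 ≤ ‖H01.grad v‖ ^ 2 := by
  obtain ⟨C, hC⟩ := exists_norm_fn_sq_le hd hDb
  refine ⟨(C + 1 : ℝ)⁻¹, by positivity, fun v => ?_⟩
  rw [inv_mul_le_iff₀ (by positivity), H01_norm_sq]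
  linarith [hC v]

/-! ### The embedding of `H_0^1(D)` into `H_0^s(D)` -/

theorem gagliardoMeasure_absolutelyContinuous {d : ℕ} (D : Set (RSpace d)) (s : ℝ) :
    gagliardoMeasure D s ≪ (volOn D).prod (volOn D) := by
  unfold gagliardoMeasure
  split_ifs
  · exact Measure.AbsolutelyContinuous.zero _
  · exact withDensity_absolutelyContinuous _ _

theorem ae_gagliardoMeasure {d : ℕ} {D : Set (RSpace d)} (s : ℝ) {P : RSpace d → Prop}
    (h : ∀ᵐ x ∂volOn D, P x) : ∀ᵐ z ∂gagliardoMeasure D s, P z.1 ∧ P z.2 :=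
  (gagliardoMeasure_absolutelyContinuous D s).ae_le
    ((Measure.quasiMeasurePreserving_fst.ae h).and (Measure.quasiMeasurePreserving_snd.ae h))

theorem testPairsFrac_snd {d : ℕ} {D : Set (RSpace d)} {s : ℝ}
    {p : WithLp 2 (Lp ℝ 2 (volOn D) × Lp ℝ 2 (gagliardoMeasure D s))}
    (hp : p ∈ testPairsFrac D s) :
    p.snd =ᵐ[gagliardoMeasure D s] fun z => p.fst z.1 - p.fst z.2 := by
  obtain ⟨φ, -, h1, h2⟩ := hp
  filter_upwards [h2, ae_gagliardoMeasure s h1] with z hz hz'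
  rw [hz, hz'.1, hz'.2]

/-- From a convergent sequence in `L²` one can extract an almost everywhere convergent one. -/
theorem Lp_two_exists_seq_tendsto_ae {X E : Type*} [MeasurableSpace X] {μ : Measure X}
    [NormedAddCommGroup E] {f : ℕ → Lp E 2 μ} {g : Lp E 2 μ}
    (h : Filter.Tendsto f Filter.atTop (𝓝 g)) :
    ∃ ns : ℕ → ℕ, StrictMono ns ∧
      ∀ᵐ x ∂μ, Filter.Tendsto (fun i => f (ns i) x) Filter.atTop (𝓝 (g x)) :=
  (tendstoInMeasure_of_tendsto_Lp h).exists_seq_tendsto_ae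

/-- The second component of an element `(v, w)` of `H_0^s(D)` is `w(x, y) = v(x) - v(y)`. -/
theorem H0s_snd {d : ℕ} {D : Set (RSpace d)} {s : ℝ} (w : H0s D s) :
    w.1.snd =ᵐ[gagliardoMeasure D s] fun z => H0s.fn w z.1 - H0s.fn w z.2 := by
  obtain ⟨p, hp, hlim⟩ := mem_closure_iff_seq_limit.1 w.2
  have h1 : Filter.Tendsto (fun n => (p n).fst) Filter.atTop (𝓝 w.1.fst) :=
    (WithLp.continuous_fst 2 _ _).continuousAt.tendsto.comp hlim
  have h2 : Filter.Tendsto (fun n => (p n).snd) Filter.atTop (𝓝 w.1.snd) :=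
    (WithLp.continuous_snd 2 _ _).continuousAt.tendsto.comp hlim
  obtain ⟨ns, hns, hae⟩ := Lp_two_exists_seq_tendsto_ae h1
  obtain ⟨ms, hms, hae'⟩ := Lp_two_exists_seq_tendsto_ae (h2.comp hns.tendsto_atTop)
  have hall : ∀ᵐ z ∂gagliardoMeasure D s, ∀ n, (p n).snd z = (p n).fst z.1 - (p n).fst z.2 :=
    ae_all_iff.2 fun n => testPairsFrac_snd (hp n)
  filter_upwards [hall, ae_gagliardoMeasure s hae, hae'] with z hz hz1 hz2
  refine tendsto_nhds_unique hz2 ?_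
  simp only [Function.comp_apply, hz]
  exact (hz1.1.comp hms.tendsto_atTop).sub (hz1.2.comp hms.tendsto_atTop)

theorem H0s_fn_injective {d : ℕ} {D : Set (RSpace d)} {s : ℝ} :
    Function.Injective (H0s.fn : H0s D s → Lp ℝ 2 (volOn D)) := by
  intro w w' h
  refine Subtype.ext (WithLp.ofLp_injective 2 (Prod.ext h ?_))
  refine Lp.ext ((H0s_snd w).trans ?_)
  rw [h]
  exact (H0s_snd w').symm

theorem H0s_norm_sq {d : ℕ} {D : Set (RSpace d)} {s : ℝ} (w : H0s D s) :
    ‖w‖ ^ 2 = ‖H0s.fn w‖ ^ 2 + ‖w.1.snd‖ ^ 2 :=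
  WithLp.prod_norm_sq_eq_of_L2 w.1

theorem exists_H0s_of_mem_testPairs {d : ℕ} (hd : 1 ≤ d) {D : Set (RSpace d)}
    (hDm : MeasurableSet D) (hDb : Bornology.IsBounded D) {s : ℝ} (hs : s < 1) :
    ∃ C : ℝ, 0 < C ∧ ∀ p ∈ testPairs D, ∃ w : H0s D s, H0s.fn w = p.fst ∧ ‖w‖ ≤ C * ‖p‖ := by
  obtain ⟨C, hC⟩ := exists_gagliardo_const hd hDm hDb hs
  refine ⟨Real.sqrt (1 + C), by positivity, ?_⟩
  rintro p ⟨φ, hφ, h1, h2⟩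
  have hC' := hC φ hφ
  rw [← lintegral_enorm_sq_congr h2] at hC'
  have hcont : Continuous (fun z : RSpace d × RSpace d => φ z.1 - φ z.2) := by
    have := hφ.contDiff.continuous
    fun_prop
  have hmem : MemLp (fun z : RSpace d × RSpace d => φ z.1 - φ z.2) 2 (gagliardoMeasure D s) := by
    refine ⟨hcont.aestronglyMeasurable, ?_⟩
    have h := eLpNorm_nnreal_pow_eq_lintegral (f := fun z : RSpace d × RSpace d => φ z.1 - φ z.2)
      (μ := gagliardoMeasure D s) (p := 2) two_ne_zero
    have h3 : (eLpNorm (fun z : RSpace d × RSpace d => φ z.1 - φ z.2) 2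
        (gagliardoMeasure D s)) ^ 2 < ∞ := by
      calc _ = ∫⁻ z, ‖φ z.1 - φ z.2‖ₑ ^ 2 ∂(gagliardoMeasure D s) := by simpa using h
        _ ≤ _ := hC'
        _ < ∞ := by
          rw [← Lp_two_enorm_sq]
          exact ENNReal.mul_lt_top ENNReal.coe_lt_top (ENNReal.pow_lt_top enorm_lt_top)
    exact (ENNReal.pow_lt_top_iff.1 h3).resolve_right two_ne_zero
  have hw : WithLp.toLp 2 (p.fst, hmem.toLp) ∈ testPairsFrac D s :=
    ⟨φ, hφ, h1, hmem.coeFn_toLp⟩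
  refine ⟨⟨_, subset_closure hw⟩, rfl, ?_⟩
  have h4 : ‖hmem.toLp‖ ^ 2 ≤ C * ‖p.snd‖ ^ 2 := by
    refine Lp_two_norm_sq_le ?_
    rw [lintegral_enorm_sq_congr hmem.coeFn_toLp]
    exact hC'
  rw [← Real.sqrt_sq (norm_nonneg p), ← Real.sqrt_mul (by positivity)]
  refine Real.le_sqrt_of_sq_le ?_
  rw [H0s_norm_sq, WithLp.prod_norm_sq_eq_of_L2]
  change ‖p.fst‖ ^ 2 + ‖hmem.toLp‖ ^ 2 ≤ _
  nlinarith [sq_nonneg ‖p.fst‖, sq_nonneg ‖p.snd‖, C.2, mul_nonneg C.2 (sq_nonneg ‖p.fst‖)]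

/-- If `pₙ → v` for test pairs `pₙ`, then the corresponding elements of `H_0^s(D)` form a Cauchy
sequence, because differences of test pairs are test pairs. -/
theorem exists_H0s_of_H01 {d : ℕ} (hd : 1 ≤ d) {D : Set (RSpace d)}
    (hDm : MeasurableSet D) (hDb : Bornology.IsBounded D) {s : ℝ} (hs : s < 1) :
    ∃ C : ℝ, 0 < C ∧ ∀ v : H01 D, ∃ w : H0s D s, H0s.fn w = H01.fn v ∧ ‖w‖ ≤ C * ‖v‖ := by
  obtain ⟨C, hC, h⟩ := exists_H0s_of_mem_testPairs hd hDm hDb hs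
  refine ⟨C, hC, fun v => ?_⟩
  obtain ⟨p, hp, hlim⟩ := mem_closure_iff_seq_limit.1 v.2
  choose w hw hwC using fun n => h (p n) (hp n)
  have hdist : ∀ m n, dist (w m) (w n) ≤ C * dist (p m) (p n) := by
    intro m n
    obtain ⟨w', hw', hC'⟩ := h (p m - p n) (Submodule.sub_mem _ (hp m) (hp n))
    have : w' = w m - w n := by
      refine H0s_fn_injective (hw'.trans ?_)
      change _ = H0s.fn (w m) - H0s.fn (w n)
      rw [hw, hw]
      rfl
    rw [dist_eq_norm, dist_eq_norm, ← this]
    exact hC'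
  have : CompleteSpace (H0s D s) :=
    (Submodule.isClosed_topologicalClosure _).completeSpace_coe
  have hcau : CauchySeq w := by
    rw [Metric.cauchySeq_iff']
    intro ε hε
    obtain ⟨N, hN⟩ := Metric.cauchySeq_iff'.1 hlim.cauchySeq (ε / C) (by positivity)
    refine ⟨N, fun n hn => (hdist n N).trans_lt ?_⟩
    have := hN n hn
    rwa [lt_div_iff₀' hC] at this
  obtain ⟨w₀, hw₀⟩ := cauchySeq_tendsto_of_complete hcau
  refine ⟨w₀, ?_, ?_⟩
  · have h1 : Filter.Tendsto (fun n => (p n).fst) Filter.atTop (𝓝 v.1.fst) :=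
      (WithLp.continuous_fst 2 _ _).continuousAt.tendsto.comp hlim
    have h2 : Filter.Tendsto (fun n => (w n).1.fst) Filter.atTop (𝓝 w₀.1.fst) :=
      ((WithLp.continuous_fst 2 _ _).comp continuous_subtype_val).continuousAt.tendsto.comp hw₀
    exact tendsto_nhds_unique h2 (h1.congr fun n => (hw n).symm)
  · exact le_of_tendsto_of_tendsto' hw₀.norm (hlim.norm.const_mul C) hwC

/-- For `s < 1` the space `H_0^1(D)` is continuously embedded into `H_0^s(D)`. -/
theorem exists_embedding_H01_H0s {d : ℕ} (hd : 1 ≤ d) {D : Set (RSpace d)}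
    (hDm : MeasurableSet D) (hDb : Bornology.IsBounded D) {s : ℝ} (hs : s < 1) :
    ∃ E : H01 D →L[ℝ] H0s D s, ∀ v, H0s.fn (E v) = H01.fn v := by
  obtain ⟨C, -, h⟩ := exists_H0s_of_H01 hd hDm hDb hs
  choose E hE hEC using h
  refine ⟨LinearMap.mkContinuous
    { toFun := E
      map_add' := fun u v => H0s_fn_injective ((hE _).trans ?_)
      map_smul' := fun c u => H0s_fn_injective ((hE _).trans ?_) } C hEC, hE⟩
  · change H01.fn u + H01.fn v = H0s.fn (E u) + H0s.fn (E v)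
    rw [hE, hE]
  · change c • H01.fn u = c • H0s.fn (E u)
    rw [hE]

/-! ### The finite element space is closed -/

theorem memLp_eval_mvPolynomial {d : ℕ} {D : Set (RSpace d)} (hDm : MeasurableSet D)
    (hDb : Bornology.IsBounded D) (p : MvPolynomial (Fin d) ℝ) :
    MemLp (fun x : RSpace d => MvPolynomial.eval (fun i => x i) p) 2 (volOn D) := by
  have hc : Continuous (fun x : RSpace d => MvPolynomial.eval (fun i => x i) p) :=
    (MvPolynomial.continuous_eval p).comp (by fun_prop)
  have : IsFiniteMeasure (volOn D) := ⟨by simpa using hDb.measure_lt_top⟩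
  obtain ⟨C, hC⟩ := hDb.isCompact_closure.exists_bound_of_continuousOn hc.continuousOn
  refine MemLp.of_bound hc.aestronglyMeasurable C ?_
  filter_upwards [ae_restrict_mem hDm] with x hx using hC x (subset_closure hx)

/-- The polynomials of degree at most `r`, as elements of `L²(D ∩ K)`. -/
noncomputable def polyToLp {d : ℕ} {D : Set (RSpace d)} (hDm : MeasurableSet D)
    (hDb : Bornology.IsBounded D) (K : Set (RSpace d)) (r : ℕ) :
    MvPolynomial.restrictTotalDegree (Fin d) ℝ r →ₗ[ℝ] Lp ℝ 2 ((volOn D).restrict K) where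
  toFun p := ((memLp_eval_mvPolynomial hDm hDb p.1).restrict K).toLp
  map_add' p q := by
    rw [← MemLp.toLp_add]
    congr 1
    funext x
    simp
  map_smul' c p := by
    rw [RingHom.id_apply, ← MemLp.toLp_const_smul]
    congr 1
    funext x
    simp

/-- The finite element space need not have finite dimension, since the cells may miss a subset of
`D` of positive measure. It is closed because the polynomials of degree at most `r` have finite
dimension in `L²(K)` for each cell `K`. -/
theorem isClosed_feSpace {d : ℕ} {D : Set (RSpace d)} (hDm : MeasurableSet D)
    (hDb : Bornology.IsBounded D) (T : FEPartition D) (r : ℕ) :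
    IsClosed (feSpace T r : Set (H01 D)) := by
  have hset : (feSpace T r : Set (H01 D)) = ⋂ K ∈ T.cells,
      (fun v : H01 D => LpToLpRestrictCLM (RSpace d) ℝ ℝ (volOn D) 2 K (H01.fn v)) ⁻¹'
        (LinearMap.range (polyToLp hDm hDb K r) : Set (Lp ℝ 2 ((volOn D).restrict K))) := by
    ext v
    simp only [Set.mem_iInter, Set.mem_preimage, SetLike.mem_coe, LinearMap.mem_range]
    refine forall₂_congr fun K hK => ?_
    have hKD : (volOn D).restrict K = volume.restrict K :=
      Measure.restrict_restrict_of_subset (T.subset K hK)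
    rw [← hKD]
    have hv := LpToLpRestrictCLM_coeFn ℝ K (H01.fn v)
    constructor
    · rintro ⟨p, hp, hvp⟩
      refine ⟨⟨p, (MvPolynomial.mem_restrictTotalDegree _ _ _).2 hp⟩, Lp.ext ?_⟩
      exact (MemLp.coeFn_toLp ((memLp_eval_mvPolynomial hDm hDb p).restrict K)).trans
        (hvp.symm.trans hv.symm)
    · rintro ⟨p, hp⟩
      refine ⟨p.1, (MvPolynomial.mem_restrictTotalDegree _ _ _).1 p.2, hv.symm.trans ?_⟩
      rw [← hp]
      exact MemLp.coeFn_toLp ((memLp_eval_mvPolynomial hDm hDb p.1).restrict K)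
  rw [hset]
  refine isClosed_biInter fun K _ => IsClosed.preimage ?_
    (Submodule.closed_of_finiteDimensional _)
  exact (ContinuousLinearMap.continuous _).comp
    ((WithLp.continuous_fst 2 _ _).comp continuous_subtype_val)

theorem completeSpace_feSpace {d : ℕ} {D : Set (RSpace d)} (hDm : MeasurableSet D)
    (hDb : Bornology.IsBounded D) (T : FEPartition D) (r : ℕ) : CompleteSpace (feSpace T r) := by
  have : CompleteSpace (H01 D) := (Submodule.isClosed_topologicalClosure _).completeSpace_coe
  exact (isClosed_feSpace hDm hDb T r).completeSpace_coe

/-! ### The diffusion form -/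

/-- The gradient as a continuous linear map on a subspace of `H_0^1(D)`. -/
noncomputable def gradL {d : ℕ} {D : Set (RSpace d)} (V : Submodule ℝ (H01 D)) :
    V →L[ℝ] Lp (RSpace d) 2 (volOn D) :=
  WithLp.sndL 2 ℝ _ _ ∘L (H01 D).subtypeL ∘L V.subtypeL

/-- Multiplication of a vector field in `L²` by a function in `L^∞`. -/
noncomputable def mulL {d : ℕ} (D : Set (RSpace d)) :
    Lp ℝ ∞ (volOn D) →L[ℝ] Lp (RSpace d) 2 (volOn D) →L[ℝ] Lp (RSpace d) 2 (volOn D) :=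
  (ContinuousLinearMap.lsmul ℝ ℝ).holderL (volOn D) ∞ 2 2

theorem norm_mulL_apply_le {d : ℕ} {D : Set (RSpace d)} (a : Lp ℝ ∞ (volOn D))
    (g : Lp (RSpace d) 2 (volOn D)) : ‖mulL D a g‖ ≤ ‖a‖ * ‖g‖ := by
  refine (ContinuousLinearMap.norm_holder_apply_apply_le (r := 2)
    (ContinuousLinearMap.lsmul ℝ ℝ : ℝ →L[ℝ] RSpace d →L[ℝ] RSpace d) a g).trans ?_
  rw [mul_assoc]
  exact mul_le_of_le_one_left (by positivity) ContinuousLinearMap.opNorm_lsmul_le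

theorem diffusionForm_eq_inner {d : ℕ} {D : Set (RSpace d)} (a : W1inf D)
    (u v : H01 D) :
    diffusionForm a u v = inner ℝ (mulL D (W1inf.fn a) (H01.grad u)) (H01.grad v) := by
  rw [L2.inner_def]
  refine integral_congr_ae ?_
  have h : mulL D (W1inf.fn a) (H01.grad u) =ᵐ[volOn D]
      fun x => W1inf.fn a x • H01.grad u x :=
    ContinuousLinearMap.coeFn_holder (ContinuousLinearMap.lsmul ℝ ℝ) _ _
  filter_upwards [h] with x hx
  rw [hx, real_inner_smul_left]

theorem W1inf.norm_fn_le {d : ℕ} {D : Set (RSpace d)} (a : W1inf D) : ‖W1inf.fn a‖ ≤ ‖a‖ :=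
  WithLp.norm_fst_le (x := a.1)

theorem abs_diffusionForm_le {d : ℕ} {D : Set (RSpace d)} (a : W1inf D) (u v : H01 D) :
    |diffusionForm a u v| ≤ ‖a‖ * ‖u‖ * ‖v‖ := by
  rw [diffusionForm_eq_inner]
  calc _ ≤ ‖mulL D (W1inf.fn a) (H01.grad u)‖ * ‖H01.grad v‖ := abs_real_inner_le_norm _ _
    _ ≤ ‖W1inf.fn a‖ * ‖H01.grad u‖ * ‖H01.grad v‖ := by
      gcongr
      exact norm_mulL_apply_le _ _
    _ ≤ _ := by
      gcongr
      exacts [W1inf.norm_fn_le a, H01_norm_grad_le u, H01_norm_grad_le v]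

theorem mul_norm_grad_sq_le_diffusionForm {d : ℕ} {D : Set (RSpace d)} (a : W1inf D) {α : ℝ}
    (ha : ∀ᵐ x ∂(volume.restrict D), α ≤ W1inf.fn a x) (v : H01 D) :
    α * ‖H01.grad v‖ ^ 2 ≤ diffusionForm a v v := by
  have h1 : ‖H01.grad v‖ ^ 2 = ∫ x in D, inner ℝ (H01.grad v x) (H01.grad v x) := by
    rw [← real_inner_self_eq_norm_sq, L2.inner_def]
  rw [h1, ← integral_const_mul]
  have h2 : Integrable (fun x => inner ℝ (H01.grad v x) (H01.grad v x)) (volOn D) :=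
    L2.integrable_inner _ _
  refine integral_mono_ae (h2.const_mul α) ?_ ?_
  · exact (Lp.memLp (W1inf.fn a)).integrable_mul (memLp_one_iff_integrable.2 h2)
  · filter_upwards [ha] with x hx
    exact mul_le_mul_of_nonneg_right hx real_inner_self_nonneg

theorem W1inf.continuous_fn {d : ℕ} {D : Set (RSpace d)} :
    Continuous (W1inf.fn : W1inf D → Lp ℝ ∞ (volOn D)) :=
  (WithLp.continuous_fst 1 _ _).comp continuous_subtype_val

/-! ### The recursion in an abstract Hilbert space -/

section AbstractModes

variable {V H : Type*} [NormedAddCommGroup V] [InnerProductSpace ℝ V]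
  [NormedAddCommGroup H] [InnerProductSpace ℝ H]

/-- The recursion of the modes for abstract data: `⟪M₀ G u₀, G v⟫ = F v` and
`⟪M₀ G uₙ₊₁, G v⟫ = -⟪M G uₙ, G v⟫` for all `v`. Here `G` plays the role of the gradient, and `M₀`,
`M` are the multiplications by the coefficients. -/
structure IsModes (G : V →L[ℝ] H) (M₀ M : H →L[ℝ] H) (F : V →L[ℝ] ℝ) (u : ℕ → V) : Prop where
  zero : ∀ v, inner ℝ (M₀ (G (u 0))) (G v) = F v
  succ : ∀ n v, inner ℝ (M₀ (G (u (n + 1)))) (G v) = - inner ℝ (M (G (u n))) (G v)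

/-- Testing each equation with its own solution loses a factor `1 / c` per step. -/
theorem IsModes.norm_le {G : V →L[ℝ] H} {M₀ M : H →L[ℝ] H} {F : V →L[ℝ] ℝ} {u : ℕ → V}
    (h : IsModes G M₀ M F u) {c b K R : ℝ} (hc : 0 < c) (hK : 0 ≤ K) (hR : 0 ≤ R)
    (hM₀ : ∀ v, c * ‖v‖ ^ 2 ≤ inner ℝ (M₀ (G v)) (G v))
    (hM : ∀ u v, |inner ℝ (M (G u)) (G v)| ≤ b * ‖u‖ * ‖v‖)
    (hF : ∀ v, |F v| ≤ c * K * R * ‖v‖) (hb : b ≤ c * K) (n : ℕ) :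
    ‖u n‖ ≤ K ^ (n + 1) * R := by
  have key : ∀ (v : V) (B : ℝ), 0 ≤ B → c * ‖v‖ ^ 2 ≤ c * B * ‖v‖ → ‖v‖ ≤ B := by
    intro v B hB h1
    rcases (norm_nonneg v).eq_or_lt with h0 | h0
    · rwa [← h0]
    · have h2 : c * ‖v‖ * ‖v‖ ≤ c * ‖v‖ * B := by linarith
      exact le_of_mul_le_mul_left h2 (by positivity)
  induction n with
  | zero =>
    refine key _ _ (by positivity) ((hM₀ (u 0)).trans ?_)
    rw [h.zero]
    refine ((le_abs_self _).trans (hF _)).trans_eq ?_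
    ring
  | succ n ih =>
    have h1 : ‖u (n + 1)‖ ≤ K * ‖u n‖ := by
      refine key _ _ (by positivity) ((hM₀ (u (n + 1))).trans ?_)
      rw [h.succ]
      refine ((neg_le_abs _).trans (hM _ _)).trans ?_
      rw [← mul_assoc]
      gcongr
    calc ‖u (n + 1)‖ ≤ K * ‖u n‖ := h1
      _ ≤ K * (K ^ (n + 1) * R) := by gcongr
      _ = K ^ (n + 1 + 1) * R := by ring

variable [CompleteSpace V] [CompleteSpace H]

/-- The operator `G† M G`, which represents the bilinear form `(u, v) ↦ ⟪M G u, G v⟫`. -/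
noncomputable def conjOp (G : V →L[ℝ] H) (M : H →L[ℝ] H) : V →L[ℝ] V :=
  ContinuousLinearMap.adjoint G ∘L M ∘L G

theorem inner_conjOp (G : V →L[ℝ] H) (M : H →L[ℝ] H) (u v : V) :
    inner ℝ (conjOp G M u) v = inner ℝ (M (G u)) (G v) := by
  rw [conjOp, ContinuousLinearMap.comp_apply, ContinuousLinearMap.adjoint_inner_left,
    ContinuousLinearMap.comp_apply]

theorem continuous_conjOp (G : V →L[ℝ] H) :
    Continuous (fun p : (H →L[ℝ] H) × V => conjOp G p.1 p.2) :=
  (ContinuousLinearMap.adjoint G).continuous.comp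
    (continuous_fst.clm_apply (G.continuous.comp continuous_snd))

/-- Lax–Milgram for the form `(u, v) ↦ ⟪M₀ G u, G v⟫`. -/
theorem exists_equiv_conjOp {G : V →L[ℝ] H} {M₀ : H →L[ℝ] H} {c : ℝ} (hc : 0 < c)
    (hM₀ : ∀ v, c * ‖v‖ ^ 2 ≤ inner ℝ (M₀ (G v)) (G v)) :
    ∃ A : V ≃L[ℝ] V, ∀ u v, inner ℝ (A u) v = inner ℝ (M₀ (G u)) (G v) := by
  let B : V →L[ℝ] V →L[ℝ] ℝ := ((innerSL ℝ : V →L[ℝ] V →L[ℝ] ℝ)).comp (conjOp G M₀)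
  have hB : ∀ u v, B u v = inner ℝ (M₀ (G u)) (G v) := fun u v => inner_conjOp G M₀ u v
  have hco : IsCoercive B := ⟨c, hc, fun v => by
    rw [hB, mul_assoc, ← sq]
    exact hM₀ v⟩
  exact ⟨hco.continuousLinearEquivOfBilin, fun u v =>
    (hco.continuousLinearEquivOfBilin_apply u v).trans (hB u v)⟩

/-- The modes, given by the inverse of the operator of the leading coefficient. -/
noncomputable def modes (A : V ≃L[ℝ] V) (G : V →L[ℝ] H) (M : H →L[ℝ] H) (F : V →L[ℝ] ℝ) : ℕ → V
  | 0 => A.symm ((InnerProductSpace.toDual ℝ V).symm F)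
  | n + 1 => - A.symm (conjOp G M (modes A G M F n))

theorem isModes_iff_eq_modes {G : V →L[ℝ] H} {M₀ : H →L[ℝ] H} {A : V ≃L[ℝ] V}
    (hA : ∀ u v, inner ℝ (A u) v = inner ℝ (M₀ (G u)) (G v)) (M : H →L[ℝ] H) (F : V →L[ℝ] ℝ)
    (u : ℕ → V) : IsModes G M₀ M F u ↔ u = modes A G M F := by
  constructor
  · intro h
    funext n
    induction n with
    | zero =>
      rw [modes, ← A.symm_apply_apply (u 0)]
      congr 1
      refine ext_inner_right ℝ fun v => ?_
      rw [hA, h.zero, InnerProductSpace.toDual_symm_apply]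
    | succ n ih =>
      rw [modes, ← ih, ← map_neg, ← A.symm_apply_apply (u (n + 1))]
      congr 1
      refine ext_inner_right ℝ fun v => ?_
      rw [hA, h.succ, inner_neg_left, inner_conjOp]
  · rintro rfl
    constructor
    · intro v
      rw [← hA, modes, A.apply_symm_apply, InnerProductSpace.toDual_symm_apply]
    · intro n v
      rw [← hA, modes, map_neg, A.apply_symm_apply, inner_neg_left, inner_conjOp]

theorem existsUnique_isModes {G : V →L[ℝ] H} {M₀ : H →L[ℝ] H} {c : ℝ} (hc : 0 < c)
    (hM₀ : ∀ v, c * ‖v‖ ^ 2 ≤ inner ℝ (M₀ (G v)) (G v)) (M : H →L[ℝ] H) (F : V →L[ℝ] ℝ) :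
    ∃! u, IsModes G M₀ M F u := by
  obtain ⟨A, hA⟩ := exists_equiv_conjOp hc hM₀
  exact ⟨modes A G M F, (isModes_iff_eq_modes hA M F _).2 rfl,
    fun u hu => (isModes_iff_eq_modes hA M F u).1 hu⟩

/-- Strong measurability of `ω ↦ Ψ (η ω, g ω)` for continuous `Ψ`, where `η` is only Borel
measurable with values in a possibly nonseparable space. -/
theorem aestronglyMeasurable_comp_borel {Ω X Y Z : Type*} [MeasurableSpace Ω] {P : Measure Ω}
    [TopologicalSpace X] [TopologicalSpace Y] [SecondCountableTopology Y]
    [TopologicalSpace.PseudoMetrizableSpace Y]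
    [TopologicalSpace Z] [SecondCountableTopology Z] [TopologicalSpace.PseudoMetrizableSpace Z]
    {Ψ : X × Y → Z} (hΨ : Continuous Ψ) {η : Ω → X} (hη : @AEMeasurable Ω X (borel X) _ η P)
    {g : Ω → Y} (hg : AEStronglyMeasurable g P) :
    AEStronglyMeasurable (fun ω => Ψ (η ω, g ω)) P := by
  borelize X Y Z
  exact (Continuous.aemeasurable2 (c := fun x y => Ψ (x, y)) hΨ hη
    hg.aemeasurable).aestronglyMeasurable

theorem aestronglyMeasurable_modes [SecondCountableTopology V] {Ω X : Type*} [MeasurableSpace Ω]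
    {P : Measure Ω} [TopologicalSpace X] {M : X → H →L[ℝ] H} (hM : Continuous M)
    {η : Ω → X} (hη : @AEMeasurable Ω X (borel X) _ η P) {F : Ω → V →L[ℝ] ℝ}
    (hF : AEStronglyMeasurable F P) (A : V ≃L[ℝ] V) (G : V →L[ℝ] H) (n : ℕ) :
    AEStronglyMeasurable (fun ω => modes A G (M (η ω)) (F ω) n) P := by
  induction n with
  | zero =>
    exact (A.symm.continuous.comp
      (InnerProductSpace.toDual ℝ V).symm.continuous).comp_aestronglyMeasurable hF
  | succ n ih =>
    have h : Continuous (fun p : X × V => - A.symm (conjOp G (M p.1) p.2)) :=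
      (A.symm.continuous.comp ((continuous_conjOp G).comp
        ((hM.comp continuous_fst).prodMk continuous_snd))).neg
    exact aestronglyMeasurable_comp_borel h hη ih

theorem IsModes.aestronglyMeasurable [SecondCountableTopology V] {Ω X : Type*}
    [MeasurableSpace Ω] {P : Measure Ω} [TopologicalSpace X] {G : V →L[ℝ] H} {M₀ : H →L[ℝ] H}
    {c : ℝ} (hc : 0 < c) (hM₀ : ∀ v, c * ‖v‖ ^ 2 ≤ inner ℝ (M₀ (G v)) (G v))
    {M : X → H →L[ℝ] H} (hM : Continuous M) {η : Ω → X} (hη : @AEMeasurable Ω X (borel X) _ η P)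
    {F : Ω → V →L[ℝ] ℝ} (hF : AEStronglyMeasurable F P) {u : Ω → ℕ → V}
    (hu : ∀ᵐ ω ∂P, IsModes G M₀ (M (η ω)) (F ω) (u ω)) (n : ℕ) :
    AEStronglyMeasurable (fun ω => u ω n) P := by
  obtain ⟨A, hA⟩ := exists_equiv_conjOp hc hM₀
  refine (aestronglyMeasurable_modes hM hη hF A G n).congr ?_
  filter_upwards [hu] with ω hω
  rw [(isModes_iff_eq_modes hA _ _ _).1 hω]

end AbstractModes

/-! ### The finite element modes -/

theorem inner_mulL_gradL {d : ℕ} {D : Set (RSpace d)} (V : Submodule ℝ (H01 D)) (a : W1inf D)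
    (u v : V) : inner ℝ (mulL D (W1inf.fn a) (gradL V u)) (gradL V v) = diffusionForm a u v :=
  (diffusionForm_eq_inner a u v).symm

/-- The recursion for finite elements is an instance of the abstract one. In the pairing `⟨F, v⟩`
the element `w` of `H_0^s(D)` with the same underlying function as `v` is unique, so it is
`E v`. -/
theorem isFEModes_iff {d : ℕ} {D : Set (RSpace d)} {s : ℝ} {E : H01 D →L[ℝ] H0s D s}
    (hE : ∀ v, H0s.fn (E v) = H01.fn v) (V : Submodule ℝ (H01 D)) (a₀ η : W1inf D)
    (F : Hneg D s) (u : ℕ → V) :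
    IsFEModes V a₀ η F u ↔ IsModes (gradL V) (mulL D (W1inf.fn a₀)) (mulL D (W1inf.fn η))
      (F ∘L E ∘L V.subtypeL) u := by
  constructor
  · intro h
    refine ⟨fun v => ?_, fun n v => ?_⟩
    · exact (inner_mulL_gradL V a₀ (u 0) v).trans (h.zero v (E v) (hE v))
    · exact (inner_mulL_gradL V a₀ (u (n + 1)) v).trans ((h.succ n v).trans
        (congrArg Neg.neg (inner_mulL_gradL V η (u n) v).symm))
  · intro h
    refine ⟨fun v w hw => ?_, fun n v => ?_⟩
    · obtain rfl : w = E v := H0s_fn_injective (hw.trans (hE v).symm)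
      exact (inner_mulL_gradL V a₀ (u 0) v).symm.trans (h.zero v)
    · exact (inner_mulL_gradL V a₀ (u (n + 1)) v).symm.trans ((h.succ n v).trans
        (congrArg Neg.neg (inner_mulL_gradL V η (u n) v)))

theorem coercive_mulL_gradL {d : ℕ} {D : Set (RSpace d)} {a₀ : W1inf D} {α c : ℝ} (hα : 0 < α)
    (ha₀ : ∀ᵐ x ∂(volume.restrict D), α ≤ W1inf.fn a₀ x)
    (hc : ∀ v : H01 D, c * ‖v‖ ^ 2 ≤ ‖H01.grad v‖ ^ 2) (V : Submodule ℝ (H01 D)) (v : V) :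
    α * c * ‖v‖ ^ 2 ≤ inner ℝ (mulL D (W1inf.fn a₀) (gradL V v)) (gradL V v) := by
  refine le_of_le_of_eq ?_ (inner_mulL_gradL V a₀ v v).symm
  rw [mul_assoc]
  exact (mul_le_mul_of_nonneg_left (hc v) hα.le).trans
    (mul_norm_grad_sq_le_diffusionForm a₀ ha₀ v)

theorem abs_inner_mulL_gradL_le {d : ℕ} {D : Set (RSpace d)} {η : W1inf D} {b : ℝ}
    (hb : ‖η‖ ≤ b) (V : Submodule ℝ (H01 D)) (u v : V) :
    |inner ℝ (mulL D (W1inf.fn η) (gradL V u)) (gradL V v)| ≤ b * ‖u‖ * ‖v‖ := by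
  refine (congrArg abs (inner_mulL_gradL V η u v)).trans_le ?_
  refine (abs_diffusionForm_le η u v).trans ?_
  exact mul_le_mul_of_nonneg_right (mul_le_mul_of_nonneg_right hb (norm_nonneg _))
    (norm_nonneg _)

theorem existsUnique_isFEModes {d : ℕ} {D : Set (RSpace d)} {s : ℝ} {E : H01 D →L[ℝ] H0s D s}
    (hE : ∀ v, H0s.fn (E v) = H01.fn v) {a₀ : W1inf D} {α c : ℝ} (hα : 0 < α)
    (ha₀ : ∀ᵐ x ∂(volume.restrict D), α ≤ W1inf.fn a₀ x) (hc : 0 < c)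
    (hcoer : ∀ v : H01 D, c * ‖v‖ ^ 2 ≤ ‖H01.grad v‖ ^ 2)
    (V : Submodule ℝ (H01 D)) [CompleteSpace V] (η : W1inf D) (F : Hneg D s) :
    ∃! u : ℕ → V, IsFEModes V a₀ η F u := by
  refine (existsUnique_congr fun u => isFEModes_iff hE V a₀ η F u).2 ?_
  exact existsUnique_isModes (mul_pos hα hc) (coercive_mulL_gradL hα ha₀ hcoer V) _ _

theorem IsFEModes.norm_le {d : ℕ} {D : Set (RSpace d)} {s : ℝ} {E : H01 D →L[ℝ] H0s D s}
    (hE : ∀ v, H0s.fn (E v) = H01.fn v) {a₀ : W1inf D} {α c : ℝ} (hα : 0 < α)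
    (ha₀ : ∀ᵐ x ∂(volume.restrict D), α ≤ W1inf.fn a₀ x) (hc : 0 < c)
    (hcoer : ∀ v : H01 D, c * ‖v‖ ^ 2 ≤ ‖H01.grad v‖ ^ 2)
    {V : Submodule ℝ (H01 D)} {η : W1inf D} {F : Hneg D s} {u : ℕ → V}
    (hu : IsFEModes V a₀ η F u) {b K : ℝ} (hη : ‖η‖ ≤ b) (hK : 0 ≤ K)
    (hKE : ‖E‖ ≤ α * c * K) (hKb : b ≤ α * c * K) (n : ℕ) :
    ‖u n‖ ≤ K ^ (n + 1) * ‖F‖ := by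
  refine IsModes.norm_le ((isFEModes_iff hE V a₀ η F u).1 hu) (mul_pos hα hc) hK
    (ContinuousLinearMap.opNorm_nonneg F) (coercive_mulL_gradL hα ha₀ hcoer V)
    (abs_inner_mulL_gradL_le hη V) (fun v => ?_) hKb n
  calc |F (E v)| ≤ ‖F‖ * ‖E v‖ := F.le_opNorm _
    _ ≤ ‖F‖ * (‖E‖ * ‖v‖) :=
      mul_le_mul_of_nonneg_left (E.le_opNorm _) (ContinuousLinearMap.opNorm_nonneg F)
    _ ≤ ‖F‖ * (α * c * K * ‖v‖) := by gcongr
    _ = _ := by ring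

theorem secondCountableTopology_submodule_H01 {d : ℕ} {D : Set (RSpace d)}
    (V : Submodule ℝ (H01 D)) : SecondCountableTopology V := by
  have : Fact ((2 : ℝ≥0∞) ≠ ∞) := ⟨by simp⟩
  have h1 : SecondCountableTopology (Lp ℝ 2 (volOn D)) := inferInstance
  have h2 : SecondCountableTopology (Lp (RSpace d) 2 (volOn D)) := inferInstance
  have h : SecondCountableTopology
    (WithLp 2 (Lp ℝ 2 (volOn D) × Lp (RSpace d) 2 (volOn D))) := inferInstance
  have h' : SecondCountableTopology (H01 D) := TopologicalSpace.Subtype.secondCountableTopology _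
  exact TopologicalSpace.Subtype.secondCountableTopology _

theorem aestronglyMeasurable_isFEModes {d : ℕ} {D : Set (RSpace d)} {s : ℝ}
    {E : H01 D →L[ℝ] H0s D s} (hE : ∀ v, H0s.fn (E v) = H01.fn v) {a₀ : W1inf D} {α c : ℝ}
    (hα : 0 < α) (ha₀ : ∀ᵐ x ∂(volume.restrict D), α ≤ W1inf.fn a₀ x) (hc : 0 < c)
    (hcoer : ∀ v : H01 D, c * ‖v‖ ^ 2 ≤ ‖H01.grad v‖ ^ 2)
    (V : Submodule ℝ (H01 D)) [CompleteSpace V] {Ω : Type*} [MeasurableSpace Ω] {P : Measure Ω}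
    {η : Ω → W1inf D} (hη : @AEMeasurable Ω (W1inf D) (borel (W1inf D)) _ η P)
    {f : Ω → Hneg D s} (hf : AEStronglyMeasurable f P) {u : Ω → ℕ → V}
    (hu : ∀ᵐ ω ∂P, IsFEModes V a₀ (η ω) (f ω) (u ω)) (n : ℕ) :
    AEStronglyMeasurable (fun ω => u ω n) P := by
  have hF : AEStronglyMeasurable (fun ω => f ω ∘L E ∘L V.subtypeL) P :=
    (ContinuousLinearMap.precomp ℝ (E ∘L V.subtypeL)).continuous.comp_aestronglyMeasurable hf
  have hM : Continuous fun a : W1inf D => mulL D (W1inf.fn a) :=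
    (mulL D).continuous.comp W1inf.continuous_fn
  have hsc := secondCountableTopology_submodule_H01 V
  have hu' : ∀ᵐ ω ∂P, IsModes (gradL V) (mulL D (W1inf.fn a₀)) (mulL D (W1inf.fn (η ω)))
      (f ω ∘L E ∘L V.subtypeL) (u ω) :=
    hu.mono fun ω hω => (isFEModes_iff hE V a₀ (η ω) (f ω) (u ω)).1 hω
  -- the instances of the nested submodule `V` are named, as unification does not find them
  refine @IsModes.aestronglyMeasurable V (Lp (RSpace d) 2 (volOn D)) V.normedAddCommGroup
    V.innerProductSpace _ _ _ _ hsc Ω (W1inf D) _ P _ (gradL V) (mulL D (W1inf.fn a₀)) (α * c)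
    (mul_pos hα hc) ?_ (fun a => mulL D (W1inf.fn a)) ?_ η hη
    (fun ω => f ω ∘L E ∘L V.subtypeL) ?_ u ?_ n
  · exact coercive_mulL_gradL hα ha₀ hcoer V
  · exact hM
  · exact hF
  · exact hu'

theorem memLp_two_and_integral_sq_le {Ω V W : Type*} [MeasurableSpace Ω] {P : Measure Ω}
    [NormedAddCommGroup V] [NormedAddCommGroup W] {u : Ω → V} {f : Ω → W} {C : ℝ}
    (hf : MemLp f 2 P) (hu : AEStronglyMeasurable u P) (h : ∀ᵐ ω ∂P, ‖u ω‖ ≤ C * ‖f ω‖) :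
    MemLp u 2 P ∧ ∫ ω, ‖u ω‖ ^ 2 ∂P ≤ C ^ 2 * ∫ ω, ‖f ω‖ ^ 2 ∂P := by
  have hmem : MemLp u 2 P := hf.of_le_mul hu h
  refine ⟨hmem, ?_⟩
  rw [← integral_const_mul]
  refine integral_mono_ae (hmem.integrable_norm_pow two_ne_zero)
    ((hf.integrable_norm_pow two_ne_zero).const_mul _) ?_
  filter_upwards [h] with ω hω
  calc ‖u ω‖ ^ 2 ≤ (C * ‖f ω‖) ^ 2 := pow_le_pow_left₀ (norm_nonneg _) hω 2
    _ = C ^ 2 * ‖f ω‖ ^ 2 := by ring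

set_option maxHeartbeats 800000 in
theorem mainTheorem4 {d : ℕ} (hd : 1 ≤ d ∧ d ≤ 3) (D : Set (RSpace d))
    (hD : IsLipschitzDomain D) (hDb : Bornology.IsBounded D)
    (a₀ : W1inf D) (α : ℝ) (hα : 0 < α) (ha₀ : ∀ᵐ x ∂(volume.restrict D), α ≤ W1inf.fn a₀ x)
    (b₀ : ℝ) (hb₀ : 0 < b₀) (σ : ℝ) (hσ : 0 < σ ∧ σ ≤ 1) :
    ∃ C₀ : ℝ, 0 < C₀ ∧
      ∀ (Ω : Type*) [MeasurableSpace Ω] (P : Measure Ω) [IsProbabilityMeasure P]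
        (η : Ω → W1inf D), @AEMeasurable Ω (W1inf D) (borel (W1inf D)) _ η P →
        (∀ᵐ ω ∂P, ‖η ω‖ ≤ b₀) →
        ∀ f : Ω → Hneg D (1 - σ), MemLp f 2 P →
        ∀ (T : FEPartition D) (r : ℕ),
          (∀ ω, ∃! w : ℕ → feSpace T r, IsFEModes (feSpace T r) a₀ (η ω) (f ω) w) ∧
          ∀ u : Ω → ℕ → feSpace T r,
            (∀ᵐ ω ∂P, IsFEModes (feSpace T r) a₀ (η ω) (f ω) (u ω)) →
            ∀ n : ℕ, MemLp (fun ω => u ω n) 2 P ∧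
              ∫ ω, ‖u ω n‖ ^ 2 ∂P ≤ C₀ ^ (n + 1) * ∫ ω, ‖f ω‖ ^ 2 ∂P := by
  have hDm : MeasurableSet D := hD.isOpen.measurableSet
  obtain ⟨E, hE⟩ := exists_embedding_H01_H0s hd.1 hDm hDb (s := 1 - σ) (by linarith [hσ.1])
  obtain ⟨c, hc, hcoer⟩ := exists_norm_sq_le_grad hd.1 hDb
  -- `K` bounds the first mode by `‖f‖` and each further mode by the one before it
  set K : ℝ := max (‖E‖ / (α * c)) (b₀ / (α * c))
  have hK0 : 0 < K := lt_max_of_lt_right (by positivity)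
  have hKE : ‖E‖ ≤ α * c * K := (div_le_iff₀' (by positivity)).1 (le_max_left _ _)
  have hKb : b₀ ≤ α * c * K := (div_le_iff₀' (by positivity)).1 (le_max_right _ _)
  refine ⟨K ^ 2, by positivity, ?_⟩
  intro Ω _ P _ η hη hηb f hf T r
  have : CompleteSpace (feSpace T r) := completeSpace_feSpace hDm hDb T r
  refine ⟨fun ω => existsUnique_isFEModes hE hα ha₀ hc hcoer (feSpace T r) (η ω) (f ω),
    fun u hu n => ?_⟩
  have hmeas : AEStronglyMeasurable (fun ω => u ω n) P :=
    aestronglyMeasurable_isFEModes (s := 1 - σ) (f := f) (u := u) (P := P) (η := η) hE hα ha₀ hc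
      hcoer (feSpace T r) hη (MemLp.aestronglyMeasurable hf) hu n
  have hbound : ∀ᵐ ω ∂P, ‖u ω n‖ ≤ K ^ (n + 1) * ‖f ω‖ := by
    filter_upwards [hu, hηb] with ω hω hb
    exact IsFEModes.norm_le (V := feSpace T r) (F := f ω) (u := u ω) (η := η ω) hE hα ha₀
      hc hcoer hω hb hK0.le hKE hKb n
  have hC : (K ^ (n + 1)) ^ 2 = (K ^ 2) ^ (n + 1) := by ring
  rw [← hC]
  exact memLp_two_and_integral_sq_le (V := feSpace T r) (W := Hneg D (1 - σ))
    (u := fun ω => u ω n) (f := f) (C := K ^ (n + 1)) hf hmeas hbound
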